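/- Throughout $\log$ is the natural logarithm. A Max 2CSP-$R$ instance has variables $X_i$ with values in a set $\Sigma$ of size $R$ and a finite collection of constraints (with nonnegative weights), each involving two variables; it is a Unique Game if every constraint has the form $x=\pi(y)$ with $\pi$ a bijection of $\Sigma$. The cost of an assignment is the fraction (by weight) of the constraints that it satisfies. A feasible solution of the SDP relaxation is a family of real vectors $x_{i,a}$ ($a\in\Sigma$) with $\sum_a\|x_{i,a}\|^2=1$ for all $i$, $\langle x_{i,a},x_{i,b}\rangle=0$ for all $i$ and $a\ne b$, and $\langle x_{i,a},x_{j,b}\rangle\ge 0$ for all $i,j,a,b$. Its cost is the weighted average, over the constraints $C$ (between $X_i$ and $X_j$, say), of $\sum\langle x_{i,a},x_{j,b}\rangle$, the sum being over the pairs $(a,b)$ that satisfy $C$. The integral optimum and the SDP optimum are the suprema of these costs. Let $R=2^k$ with $k\ge 1$ and $\eta=\frac12-\frac1{4\log R}$. In the Khot–Vishnoi instance, call two functions $f,g:\{-1,1\}^k\to\{-1,1\}$ equivalent if $f=g\chi_S$ for some character $\chi_S(x)=\prod_{i\in S}x_i$, $S\subseteq[k]$, and choose a representative of each class. The variables are the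 classes, and the values are the $R$ subsets of $[k]$. For each pair $(f,g)$, with $f=p\chi_S$, $g=q\chi_T$, and $p,q$ the representatives of their classes, there is a constraint between the two classes, satisfied exactly by the pairs of values $(S\triangle U,T\triangle U)$, $U\subseteq[k]$. Its weight is the probability of $(f,g)$ when $f$ is uniformly random and $g$ is obtained from $f$ by flipping the sign of each of its $R$ values independently with probability $\eta$. The tensored solution assigns to the class with representative $p$ and the value $S$ the vector $R^{-1/2}\,(u\otimes u)$, where $u=R^{-1/2}\,p\chi_S\in\mathbb R^R$ is a unit vector. Then: 1. the instance is a Unique Game with $R$ values whose integral optimum is positive and at most $e/R$; 2. the tensored solution is feasible for the SDP relaxation and has cost at least $(1-2\eta)^2=\frac1{4(\log R)^2}$; so the SDP optimum is at least $\frac1{4(\log R)^2}$, and the ratio of the SDP optimum to the integral optimum is at least $\frac{R}{4e(\log R)^2}$. Consequently the SDP relaxation of Max 2CSP-$R$ has integrality gap $\Omega(R/(\log R)^2)$: there is an absolute constant $c>0$ such that for every integer $R\ge2$ the supremum of the ratio of the SDP optimum to the integral optimum, over all unweighted Max 2CSP-$R$ instances (repeated constraints allowed, each constraint involving two distinct variables)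 with positive integral optimum, is at least $c\,R/(\log R)^2$. -/

import Mathlib

open scoped ENNReal TensorProduct

noncomputable section

/-! ### Weighted Max 2CSP instances -/

/-- A (weighted) Max 2CSP instance with variables `V`, labels (values) `L` and constraints indexed
by `E`. The constraint `e` involves the variables `left e` and `right e`, and is satisfied by the
values `a`, `b` of these two variables iff `sat e a b`. A collection of constraints in the
unweighted sense, repetitions allowed, is an instance all of whose weights are `1`. -/
structure TwoCSP (V L E : Type*) where
  left : E → V
  right : E → V
  sat : E → L → L → Prop
  weight : E → ℝ
  weight_nonneg : ∀ e, 0 ≤ weight e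

namespace TwoCSP

variable {V L E : Type*}

/-- All constraints count the same. -/
def IsUnweighted (I : TwoCSP V L E) : Prop := ∀ e, I.weight e = 1

/-- Every constraint involves two different variables. -/
def IsLoopless (I : TwoCSP V L E) : Prop := ∀ e, I.left e ≠ I.right e

/-- Every constraint has the form `x = π y`, with `π` a bijection of the label set. -/
def IsUniqueGame (I : TwoCSP V L E) : Prop :=
  ∀ e, ∃ π : L ≃ L, ∀ a b, I.sat e a b ↔ a = π b

/-- The total weight of the constraints. -/
def totalWeight [Fintype E] (I : TwoCSP V L E) : ℝ := ∑ e, I.weight e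

open Classical in
/-- The cost of an assignment: the fraction of the constraints (by weight) that it satisfies. -/
def cost [Fintype E] (I : TwoCSP V L E) (A : V → L) : ℝ :=
  (∑ e, I.weight e * (if I.sat e (A (I.left e)) (A (I.right e)) then 1 else 0)) / I.totalWeight

/-- The integral optimum: the largest cost of an assignment. -/
def opt [Fintype E] (I : TwoCSP V L E) : ℝ := ⨆ A : V → L, I.cost A

open Classical in
/-- The cost of a family of vectors `x i a` in the semidefinite relaxation. Each constraint is
replaced by the conjunctions `(X_i = a) ∧ (X_j = b)`, one for each of its satisfying pairs
`(a, b)`, and such a conjunction contributes `⟪x i a, x j b⟫`. -/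
def sdpCost [Fintype E] [Fintype L] {H : Type*} [NormedAddCommGroup H] [InnerProductSpace ℝ H]
    (I : TwoCSP V L E) (x : V → L → H) : ℝ :=
  (∑ e, I.weight e * ∑ a, ∑ b,
    (if I.sat e a b then inner ℝ (x (I.left e) a) (x (I.right e) b) else 0)) / I.totalWeight

end TwoCSP

/-- The constraints of the semidefinite relaxation. -/
structure SDPFeasible {V L H : Type*} [Fintype L] [NormedAddCommGroup H] [InnerProductSpace ℝ H]
    (x : V → L → H) : Prop where
  sum_norm_sq : ∀ i, ∑ a, ‖x i a‖ ^ 2 = 1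
  orthogonal : ∀ i a b, a ≠ b → inner ℝ (x i a) (x i b) = 0
  nonneg : ∀ i j a b, 0 ≤ inner ℝ (x i a) (x j b)

/-- The optimum of the semidefinite relaxation: the supremum of the costs of its feasible
solutions, in any finite dimension. -/
def TwoCSP.sdpOpt {V L E : Type*} [Fintype E] [Fintype L] (I : TwoCSP V L E) : ℝ :=
  sSup {c : ℝ | ∃ (d : ℕ) (x : V → L → EuclideanSpace ℝ (Fin d)),
    SDPFeasible x ∧ c = I.sdpCost x}

/-- The integrality gap of the semidefinite relaxation of Max 2CSP-`R`: the supremum of the ratio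
of the two optima, over all unweighted instances with values in a set of size `R`. -/
def integralityGap (R : ℕ) : ℝ≥0∞ :=
  ⨆ (n : ℕ) (m : ℕ) (I : TwoCSP (Fin n) (Fin R) (Fin m)) (_ : I.IsUnweighted)
    (_ : I.IsLoopless) (_ : 0 < I.opt), ENNReal.ofReal (I.sdpOpt / I.opt)

/-! ### The Khot–Vishnoi instance -/

namespace KhotVishnoi

/-- The cube `{-1, 1}^k`. -/
abbrev Cube (k : ℕ) : Type := Fin k → ℤˣ

/-- Functions `{-1, 1}^k → {-1, 1}`, a group under pointwise multiplication. -/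
abbrev BoolFn (k : ℕ) : Type := Cube k → ℤˣ

/-- The character `χ_S (x) = ∏_{i ∈ S} x_i`. -/
def chi {k : ℕ} (S : Finset (Fin k)) : BoolFn k := fun x => ∏ i ∈ S, x i

theorem chi_mul {k : ℕ} (S T : Finset (Fin k)) : chi S * chi T = chi (symmDiff S T) := by
  funext x
  simp only [chi, Pi.mul_apply]
  have hS : ∏ i ∈ S, x i = (∏ i ∈ S \ T, x i) * ∏ i ∈ S ∩ T, x i := by
    rw [← Finset.prod_union (Finset.disjoint_sdiff_inter S T), Finset.sdiff_union_inter]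
  have hT : ∏ i ∈ T, x i = (∏ i ∈ T \ S, x i) * ∏ i ∈ S ∩ T, x i := by
    rw [Finset.inter_comm, ← Finset.prod_union (Finset.disjoint_sdiff_inter T S),
      Finset.sdiff_union_inter]
  have hU : ∏ i ∈ symmDiff S T, x i = (∏ i ∈ S \ T, x i) * ∏ i ∈ T \ S, x i := by
    rw [symmDiff_def, Finset.sup_eq_union, Finset.prod_union disjoint_sdiff_sdiff]
  rw [hS, hT, hU, mul_mul_mul_comm, Int.units_mul_self, mul_one]

/-- Two functions are equivalent if they differ by a character. -/
def classSetoid (k : ℕ) : Setoid (BoolFn k) where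
  r f g := ∃ S : Finset (Fin k), f = g * chi S
  iseqv :=
    { refl := fun f => ⟨∅, by funext x; simp [chi]⟩
      symm := by
        rintro f g ⟨S, rfl⟩
        refine ⟨S, ?_⟩
        rw [mul_assoc, chi_mul, symmDiff_self]
        funext x
        simp [chi]
      trans := by
        rintro f g h ⟨S, rfl⟩ ⟨T, rfl⟩
        exact ⟨symmDiff T S, by rw [mul_assoc, chi_mul]⟩ }

/-- The variables of the instance: the equivalence classes of functions. -/
abbrev Class (k : ℕ) : Type := Quotient (classSetoid k)

/-- The class of a function. -/
def cls {k : ℕ} (f : BoolFn k) : Class k := Quotient.mk (classSetoid k) f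

/-- The chosen representative `p` of a class. -/
def rep {k : ℕ} (v : Class k) : BoolFn k := Quotient.out v

/-- The instance with `R = 2 ^ k` labels, the subsets of `Fin k`, and with noise `η`. There is
a constraint for every pair `(f, g)`, between the classes of `f` and `g`, whose weight is the
probability of `(f, g)` when `f` is uniform and `g` is obtained from `f` by changing the sign of
each of the `R` values independently with probability `η`. If `f = p χ_S` and `g = q χ_T`, with
`p` and `q` the representatives of the two classes, then the satisfying pairs of labels are the
pairs `(S ∆ U, T ∆ U)`. -/
def game (k : ℕ) (η : unitInterval) :
    TwoCSP (Class k) (Finset (Fin k)) (BoolFn k × BoolFn k) where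
  left e := cls e.1
  right e := cls e.2
  sat e a b := ∃ S T U : Finset (Fin k), e.1 = rep (cls e.1) * chi S ∧
    e.2 = rep (cls e.2) * chi T ∧ a = symmDiff S U ∧ b = symmDiff T U
  weight e := (Fintype.card (BoolFn k) : ℝ)⁻¹ *
    ∏ x : Cube k, (if e.1 x = e.2 x then 1 - (η : ℝ) else (η : ℝ))
  weight_nonneg e := by
    refine mul_nonneg (by positivity) (Finset.prod_nonneg fun x _ => ?_)
    split_ifs
    · linarith [η.2.2]
    · exact η.2.1

/-- The unit vector in `ℝ^R` with coordinates `f x / √R`. -/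
def unitVec {k : ℕ} (f : BoolFn k) : EuclideanSpace ℝ (Cube k) :=
  WithLp.toLp 2 fun x => ((f x : ℤ) : ℝ) / √(2 ^ k : ℝ)

/-- The tensored solution: the label `S` of a class with representative `p` gets the tensor square
of the unit vector of `p χ_S`, scaled to length `1 / √R`. -/
def tensoredSolution (k : ℕ) (v : Class k) (S : Finset (Fin k)) :
    EuclideanSpace ℝ (Cube k) ⊗[ℝ] EuclideanSpace ℝ (Cube k) :=
  (√(2 ^ k : ℝ))⁻¹ • (unitVec (rep v * chi S) ⊗ₜ[ℝ] unitVec (rep v * chi S))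

theorem noise_mem (k : ℕ) : 1 / 2 - 1 / (4 * Real.log (2 ^ k)) ∈ unitInterval := by
  rcases Nat.eq_zero_or_pos k with rfl | hk
  · norm_num
  · have h1 : (1 : ℝ) ≤ k := by exact_mod_cast hk
    have h2 : 1 / 2 ≤ Real.log (2 ^ k) := by
      rw [Real.log_pow]
      nlinarith [Real.log_two_gt_d9]
    have h3 : 1 / (4 * Real.log (2 ^ k)) ≤ 1 / 2 :=
      one_div_le_one_div_of_le (by norm_num) (by linarith)
    have h4 : 0 ≤ 1 / (4 * Real.log (2 ^ k)) := by positivity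
    exact ⟨by linarith, by linarith⟩

/-- The noise `η = 1/2 - 1/(4 log R)` for `R = 2 ^ k`. -/
def noise (k : ℕ) : unitInterval := ⟨1 / 2 - 1 / (4 * Real.log (2 ^ k)), noise_mem k⟩

end KhotVishnoi

end

open scoped ENNReal TensorProduct

noncomputable section

/-! ### Hypercontractivity on the discrete cube -/

/-! Put r = 1 - 2η, the correlation of the noise. Soundness is small-set expansion of the noisy
cube. An assignment selects from each class the one function carrying its assigned label, a set of
density 1/R. Multiplying f and g by the same character preserves the noise, so the satisfied weight
is R times the probability that f and g are both selected. Two-function hypercontractivity with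
exponent 1 + r (`sum_prod_signKernel_le`) bounds this by R · R^(-2/(1+r)) ≤ R^(2r) / R, which is e /
R when r = 1/(2 log R) (`sum_weight_sat_le`).

Completeness: inner products of tensor squares are squares, hence nonnegative, and distinct
characters are orthogonal, so the tensored solution is feasible. Its cost is the mean of ⟪u_f,
u_g⟫², at least the square of the mean of ⟪u_f, u_g⟫, which is r²
(`sq_le_sdpCost_tensoredSolution`).

For the gap at every R, three defects are repaired. The rational correlation 1/(2k) makes the
weights integer multiples of one number, so they become repeated constraints; the bipartite double
cover removes loops, which is why soundness allows two assignments; and the largest 2^k ≤ R is used,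
with the extra labels in no satisfying pair. Each costs at most a constant factor. -/

theorem two_mul_le_rpow_sub_rpow {r t : ℝ} (hr0 : 0 ≤ r) (hr1 : r ≤ 1) (ht0 : 0 ≤ t)
    (ht1 : t ≤ 1) : 2 * (r * t) ≤ (1 + t) ^ r - (1 - t) ^ r := by
  rcases hr0.eq_or_lt with rfl | hr
  · simp
  let h : ℝ → ℝ := fun t => (1 + t) ^ r - (1 - t) ^ r - 2 * (r * t)
  have hmono : MonotoneOn h (Set.Icc 0 1) := by
    refine monotoneOn_of_deriv_nonneg (convex_Icc 0 1) ?_ ?_ ?_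
    · refine ContinuousOn.sub (ContinuousOn.sub ?_ ?_) (by fun_prop)
      · exact ContinuousOn.rpow_const (by fun_prop) fun _ _ => Or.inr hr.le
      · exact ContinuousOn.rpow_const (by fun_prop) fun _ _ => Or.inr hr.le
    all_goals
      rw [interior_Icc]
      have key : ∀ s ∈ Set.Ioo (0 : ℝ) 1, HasDerivAt h
          (1 * r * (1 + s) ^ (r - 1) - (-1) * r * (1 - s) ^ (r - 1) - 2 * (r * 1)) s := by
        intro s hs
        have h1 : HasDerivAt (fun s : ℝ => 1 + s) 1 s := (hasDerivAt_id s).const_add 1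
        have h2 : HasDerivAt (fun s : ℝ => 1 - s) (-1) s := (hasDerivAt_id s).const_sub 1
        exact ((h1.rpow_const (Or.inl (by linarith [hs.1]))).sub
          (h2.rpow_const (Or.inl (by linarith [hs.2])))).sub
          (((hasDerivAt_id s).const_mul r).const_mul 2)
    · exact fun s hs => (key s hs).differentiableAt.differentiableWithinAt
    · intro s hs
      rw [(key s hs).deriv]
      have hp : 0 < (1 + s) := by linarith [hs.1]
      have hm : 0 < (1 - s) := by linarith [hs.2]
      -- The two powers multiply to (1 - s²)^(r-1) ≥ 1, so by AM-GM their sum is at least 2; this is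
      -- the sign of the derivative.
      have hprod : 1 ≤ (1 + s) ^ (r - 1) * (1 - s) ^ (r - 1) := by
        rw [← Real.mul_rpow hp.le hm.le]
        exact Real.one_le_rpow_of_pos_of_le_one_of_nonpos (by positivity)
          (by nlinarith [sq_nonneg s]) (by linarith)
      have hu : 0 < (1 + s) ^ (r - 1) := Real.rpow_pos_of_pos hp _
      have hv : 0 < (1 - s) ^ (r - 1) := Real.rpow_pos_of_pos hm _
      have : 2 ≤ (1 + s) ^ (r - 1) + (1 - s) ^ (r - 1) := by
        nlinarith [sq_nonneg ((1 + s) ^ (r - 1) - (1 - s) ^ (r - 1))]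
      nlinarith
  have := hmono (Set.left_mem_Icc.2 zero_le_one) ⟨ht0, ht1⟩ ht0
  simp only [h] at this
  norm_num at this
  linarith

/-- The derivative in t of the difference of the two sides is a positive multiple of the gap in
`two_mul_le_rpow_sub_rpow`. -/
theorem one_add_le_rpow_add_rpow {r t : ℝ} (hr0 : 0 ≤ r) (hr1 : r ≤ 1) (ht0 : 0 ≤ t)
    (ht1 : t ≤ 1) :
    1 + (1 + r) / 2 * (r * t ^ 2) ≤ ((1 + t) ^ (1 + r) + (1 - t) ^ (1 + r)) / 2 := by
  let h : ℝ → ℝ := fun t =>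
    (1 + t) ^ (1 + r) + (1 - t) ^ (1 + r) - (1 + r) * r * t ^ 2
  have key : ∀ s, HasDerivAt h
      (1 * (1 + r) * (1 + s) ^ (1 + r - 1) + (-1) * (1 + r) * (1 - s) ^ (1 + r - 1)
        - (1 + r) * r * (2 * s)) s := by
    intro s
    have h1 : HasDerivAt (fun s : ℝ => 1 + s) 1 s := (hasDerivAt_id s).const_add 1
    have h2 : HasDerivAt (fun s : ℝ => 1 - s) (-1) s := (hasDerivAt_id s).const_sub 1
    have h3 : HasDerivAt (fun s : ℝ => s ^ 2) (2 * s) s := by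
      simpa using hasDerivAt_pow 2 s
    exact ((h1.rpow_const (Or.inr (by linarith))).add
      (h2.rpow_const (Or.inr (by linarith)))).sub (h3.const_mul _)
  have hmono : MonotoneOn h (Set.Icc 0 1) := by
    refine monotoneOn_of_deriv_nonneg (convex_Icc 0 1)
      (fun s _ => (key s).continuousAt.continuousWithinAt)
      (fun s _ => (key s).differentiableAt.differentiableWithinAt) ?_
    intro s hs
    rw [interior_Icc] at hs
    rw [(key s).deriv, add_sub_cancel_left]
    nlinarith [two_mul_le_rpow_sub_rpow hr0 hr1 hs.1.le hs.2.le]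
  have := hmono (Set.left_mem_Icc.2 zero_le_one) ⟨ht0, ht1⟩ ht0
  simp only [h] at this
  norm_num at this
  linarith

/-- Bonami's two-point inequality: noise of parameter √r contracts from L^(1+r) to L². Dividing by
the mean m reduces it to the values 1 ± t, where Bernoulli's inequality for the exponent (1 + r)/2 ≤
1 meets the second-order bound of `one_add_le_rpow_add_rpow`. -/
theorem two_point_sq_le {r x y : ℝ} (hr0 : 0 ≤ r) (hr1 : r ≤ 1) (hy : 0 ≤ y) (hxy : y ≤ x) :
    ((x + y) / 2) ^ 2 + r * ((x - y) / 2) ^ 2 ≤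
      (((x ^ (1 + r) + y ^ (1 + r)) / 2) ^ (1 / (1 + r))) ^ 2 := by
  have hp : 0 < 1 + r := by linarith
  rcases (hy.trans hxy).eq_or_lt with rfl | hx
  · obtain rfl : y = 0 := le_antisymm hxy hy
    simp [hp.ne']
  set m := (x + y) / 2 with hm
  have hm0 : 0 < m := by positivity
  set t := (x - y) / 2 / m with ht
  have hd : (x - y) / 2 = m * t := by rw [ht]; field_simp
  have ht0 : 0 ≤ t := div_nonneg (by linarith) hm0.le
  have ht1 : t ≤ 1 := (div_le_one hm0).2 (by rw [hm]; linarith)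
  have hx' : x = m * (1 + t) := by linear_combination hd - hm
  have hy' : y = m * (1 - t) := by linear_combination (-1 : ℝ) * hd - hm
  have hb : (1 + r * t ^ 2) ^ ((1 + r) / 2) ≤
      ((1 + t) ^ (1 + r) + (1 - t) ^ (1 + r)) / 2 := by
    refine le_trans ?_ (one_add_le_rpow_add_rpow hr0 hr1 ht0 ht1)
    exact rpow_one_add_le_one_add_mul_self (by nlinarith [sq_nonneg t, mul_nonneg hr0 (sq_nonneg t)])
      (by linarith) (by linarith)
  have hmain : (m ^ 2 * (1 + r * t ^ 2)) ^ ((1 + r) / 2) ≤ (x ^ (1 + r) + y ^ (1 + r)) / 2 := by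
    rw [hx', hy', Real.mul_rpow (by positivity) (by positivity),
      Real.mul_rpow hm0.le (by linarith), Real.mul_rpow hm0.le (by linarith)]
    have : (m ^ 2) ^ ((1 + r) / 2) = m ^ (1 + r) := by
      rw [← Real.rpow_natCast, ← Real.rpow_mul hm0.le]
      congr 1
      push_cast
      ring
    rw [this]
    nlinarith [Real.rpow_pos_of_pos hm0 (1 + r)]
  have hpow := Real.rpow_le_rpow (by positivity) hmain (by positivity : 0 ≤ 2 / (1 + r))
  rw [← Real.rpow_mul (by positivity), show (1 + r) / 2 * (2 / (1 + r)) = 1 by field_simp,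
    Real.rpow_one] at hpow
  rw [← Real.rpow_natCast (_ ^ (1 / (1 + r))), ← Real.rpow_mul (by positivity),
    show 1 / (1 + r) * ((2 : ℕ) : ℝ) = 2 / (1 + r) by push_cast; ring]
  refine le_trans (le_of_eq ?_) hpow
  rw [hd]
  ring

/-- The case of one coordinate of the two-function hypercontractive inequality. -/
theorem two_point_le {r a b c d : ℝ} (hr0 : 0 ≤ r) (hr1 : r ≤ 1) (ha : 0 ≤ a) (hb : 0 ≤ b)
    (hc : 0 ≤ c) (hd : 0 ≤ d) :
    (1 + r) / 4 * (a ^ (1 / (1 + r)) * c ^ (1 / (1 + r)) + b ^ (1 / (1 + r)) * d ^ (1 / (1 + r)))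
      + (1 - r) / 4 *
        (a ^ (1 / (1 + r)) * d ^ (1 / (1 + r)) + b ^ (1 / (1 + r)) * c ^ (1 / (1 + r)))
      ≤ ((a + b) / 2) ^ (1 / (1 + r)) * ((c + d) / 2) ^ (1 / (1 + r)) := by
  have hp : 1 + r ≠ 0 := by linarith
  have key : ∀ a b : ℝ, 0 ≤ a → 0 ≤ b →
      ((a ^ (1 / (1 + r)) + b ^ (1 / (1 + r))) / 2) ^ 2
        + r * ((a ^ (1 / (1 + r)) - b ^ (1 / (1 + r))) / 2) ^ 2
        ≤ (((a + b) / 2) ^ (1 / (1 + r))) ^ 2 := by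
    intro a b ha hb
    wlog hab : b ≤ a generalizing a b
    · have := this b a hb ha (le_of_not_ge hab)
      rw [add_comm b a, add_comm (b ^ (1 / (1 + r)))] at this
      linarith [this]
    have := two_point_sq_le hr0 hr1 (Real.rpow_nonneg hb (1 / (1 + r)))
      (Real.rpow_le_rpow hb hab (by positivity))
    rwa [← Real.rpow_mul ha, ← Real.rpow_mul hb, one_div_mul_cancel hp, Real.rpow_one,
      Real.rpow_one] at this
  have h1 := key a b ha hb
  have h2 := key c d hc hd
  have hP : 0 ≤ ((a + b) / 2) ^ (1 / (1 + r)) := by positivity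
  have hQ : 0 ≤ ((c + d) / 2) ^ (1 / (1 + r)) := by positivity
  generalize ((a + b) / 2) ^ (1 / (1 + r)) = P at *
  generalize ((c + d) / 2) ^ (1 / (1 + r)) = Q at *
  generalize a ^ (1 / (1 + r)) = a' at *
  generalize b ^ (1 / (1 + r)) = b' at *
  generalize c ^ (1 / (1 + r)) = c' at *
  generalize d ^ (1 / (1 + r)) = d' at *
  -- In terms of half sums m, m' and half differences d, d', the left side is mm' + rdd'.
  -- Cauchy–Schwarz bounds its square by (m² + rd²)(m'² + rd'²), with defect r(md' - m'd)².
  refine le_of_sq_le_sq ?_ (mul_nonneg hP hQ)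
  rw [mul_pow]
  refine le_trans ?_ (mul_le_mul h1 h2 (by positivity) (by positivity))
  have := mul_nonneg hr0
    (sq_nonneg ((a' + b') / 2 * ((c' - d') / 2) - (c' + d') / 2 * ((a' - b') / 2)))
  linarith

/-- The joint law of a uniform sign and of a copy of it with correlation `r`. -/
def signKernel (r : ℝ) (u v : ℤˣ) : ℝ := if u = v then (1 + r) / 4 else (1 - r) / 4

theorem signKernel_nonneg {r : ℝ} (hr0 : 0 ≤ r) (hr1 : r ≤ 1) (u v : ℤˣ) :
    0 ≤ signKernel r u v := by
  unfold signKernel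
  split_ifs <;> linarith

theorem sum_intUnits {M : Type*} [AddCommMonoid M] (f : ℤˣ → M) : ∑ u, f u = f 1 + f (-1) := by
  rw [show (Finset.univ : Finset ℤˣ) = {1, -1} from rfl, Finset.sum_pair (by decide)]

/-- Tensorization: with the first coordinate fixed, induction applies to the remaining ones, and the
resulting means `M`, `N` enter with the same power 1/(1+r), ready for `two_point_le`. Stating the
bound for powers of F and G makes this step close up. -/
theorem sum_prod_signKernel_fin_le {r : ℝ} (hr0 : 0 ≤ r) (hr1 : r ≤ 1) (n : ℕ) :
    ∀ F G : (Fin n → ℤˣ) → ℝ, (∀ f, 0 ≤ F f) → (∀ f, 0 ≤ G f) →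
      ∑ f, ∑ g, (∏ i, signKernel r (f i) (g i)) * (F f ^ (1 / (1 + r)) * G g ^ (1 / (1 + r)))
        ≤ ((∑ f, F f) / 2 ^ n) ^ (1 / (1 + r)) * ((∑ g, G g) / 2 ^ n) ^ (1 / (1 + r)) := by
  induction n with
  | zero => intro F G _ _; simp
  | succ n ih =>
    intro F G hF hG
    have hsum : ∀ H : (Fin (n + 1) → ℤˣ) → ℝ,
        ∑ f, H f = ∑ u : ℤˣ, ∑ f : Fin n → ℤˣ, H (Fin.cons u f) := fun H => by
      rw [← Fintype.sum_prod_type']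
      exact ((Fin.consEquiv fun _ => ℤˣ).sum_comp H).symm
    set M : ℤˣ → ℝ := fun u => (∑ f : Fin n → ℤˣ, F (Fin.cons u f)) / 2 ^ n with hM
    set N : ℤˣ → ℝ := fun u => (∑ f : Fin n → ℤˣ, G (Fin.cons u f)) / 2 ^ n with hN
    have hM0 : ∀ u, 0 ≤ M u := fun u => div_nonneg (Finset.sum_nonneg fun _ _ => hF _) (by positivity)
    have hN0 : ∀ u, 0 ≤ N u := fun u => div_nonneg (Finset.sum_nonneg fun _ _ => hG _) (by positivity)
    calc _ = ∑ u : ℤˣ, ∑ v : ℤˣ, signKernel r u v *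
          ∑ f : Fin n → ℤˣ, ∑ g : Fin n → ℤˣ, (∏ i, signKernel r (f i) (g i)) *
            (F (Fin.cons u f) ^ (1 / (1 + r)) * G (Fin.cons v g) ^ (1 / (1 + r))) := by
          rw [hsum]
          refine Finset.sum_congr rfl fun u _ => ?_
          simp_rw [hsum]
          rw [Finset.sum_comm]
          refine Finset.sum_congr rfl fun v _ => ?_
          simp_rw [Finset.mul_sum, Fin.prod_univ_succ, Fin.cons_zero, Fin.cons_succ, mul_assoc]
      _ ≤ ∑ u : ℤˣ, ∑ v : ℤˣ, signKernel r u v *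
          (M u ^ (1 / (1 + r)) * N v ^ (1 / (1 + r))) := by
          refine Finset.sum_le_sum fun u _ => Finset.sum_le_sum fun v _ =>
            mul_le_mul_of_nonneg_left ?_ (signKernel_nonneg hr0 hr1 u v)
          exact ih (fun f => F (Fin.cons u f)) (fun g => G (Fin.cons v g))
            (fun _ => hF _) (fun _ => hG _)
      _ ≤ ((M 1 + M (-1)) / 2) ^ (1 / (1 + r)) * ((N 1 + N (-1)) / 2) ^ (1 / (1 + r)) := by
          refine le_trans (le_of_eq ?_)
            (two_point_le hr0 hr1 (hM0 1) (hM0 (-1)) (hN0 1) (hN0 (-1)))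
          simp only [sum_intUnits, signKernel, if_pos, if_neg (show (1 : ℤˣ) ≠ -1 by decide),
            if_neg (show (-1 : ℤˣ) ≠ 1 by decide)]
          ring
      _ = _ := by
          rw [hsum F, hsum G, sum_intUnits, sum_intUnits, hM, hN, ← add_div, ← add_div, div_div,
            div_div, pow_succ]

/-- The two-function hypercontractive inequality on the cube, for the functions `F ^ (1 / (1 + r))`
and `G ^ (1 / (1 + r))`. -/
theorem sum_prod_signKernel_le {r : ℝ} (hr0 : 0 ≤ r) (hr1 : r ≤ 1) {ι : Type*} [Fintype ι]
    [DecidableEq ι] (F G : (ι → ℤˣ) → ℝ) (hF : ∀ f, 0 ≤ F f) (hG : ∀ f, 0 ≤ G f) :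
    ∑ f, ∑ g, (∏ i, signKernel r (f i) (g i)) * (F f ^ (1 / (1 + r)) * G g ^ (1 / (1 + r)))
      ≤ ((∑ f, F f) / 2 ^ Fintype.card ι) ^ (1 / (1 + r)) *
        ((∑ g, G g) / 2 ^ Fintype.card ι) ^ (1 / (1 + r)) := by
  have e := Fintype.equivFin ι
  have hsum : ∀ H : (ι → ℤˣ) → ℝ, ∑ f, H f = ∑ f : Fin (Fintype.card ι) → ℤˣ, H (f ∘ e) :=
    fun H => ((e.symm.arrowCongr (Equiv.refl ℤˣ)).sum_comp H).symm
  have := sum_prod_signKernel_fin_le hr0 hr1 (Fintype.card ι) (fun f => F (f ∘ e))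
    (fun g => G (g ∘ e)) (fun _ => hF _) (fun _ => hG _)
  rw [← hsum F, ← hsum G] at this
  refine le_trans (le_of_eq ?_) this
  rw [hsum]
  refine Finset.sum_congr rfl fun f _ => ?_
  rw [hsum]
  refine Finset.sum_congr rfl fun g _ => ?_
  rw [← e.prod_comp]
  rfl

/-! ### Characters, labels and the weights of the Khot–Vishnoi instance -/

namespace KhotVishnoi

variable {k : ℕ}

theorem chi_mulSingle (S : Finset (Fin k)) (i : Fin k) :
    chi S (Pi.mulSingle i (-1)) = if i ∈ S then -1 else 1 :=
  Finset.prod_pi_mulSingle' i (-1) S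

theorem chi_injective : Function.Injective (chi : Finset (Fin k) → BoolFn k) := by
  intro S T h
  ext i
  have := congrFun h (Pi.mulSingle i (-1))
  rw [chi_mulSingle, chi_mulSingle] at this
  split_ifs at this with h1 h2 h2
  · simp [h1, h2]
  · exact absurd this (by decide)
  · exact absurd this (by decide)
  · simp [h1, h2]

theorem chi_mul_self (S : Finset (Fin k)) : chi S * chi S = 1 := by
  funext x
  exact Int.units_mul_self _

theorem sum_chi_eq_zero {S : Finset (Fin k)} (hS : S ≠ ∅) :
    ∑ x, (((chi S x : ℤˣ) : ℤ) : ℝ) = 0 := by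
  obtain ⟨i, hi⟩ := Finset.nonempty_iff_ne_empty.2 hS
  -- Flipping a coordinate in S permutes the cube and negates the character.
  have h := Equiv.sum_comp (Equiv.mulRight (Pi.mulSingle i (-1) : Cube k))
    fun x => (((chi S x : ℤˣ) : ℤ) : ℝ)
  have hx : ∀ x : Cube k, chi S (x * Pi.mulSingle i (-1)) = -chi S x := by
    intro x
    have : chi S (x * Pi.mulSingle i (-1)) = chi S x * chi S (Pi.mulSingle i (-1)) :=
      Finset.prod_mul_distrib
    rw [this, chi_mulSingle, if_pos hi, mul_neg_one]
  simp only [Equiv.coe_mulRight, hx, Units.val_neg, Int.cast_neg, Finset.sum_neg_distrib] at h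
  linarith

theorem exists_label (f : BoolFn k) : ∃ S : Finset (Fin k), f = rep (cls f) * chi S :=
  (classSetoid k).symm (Quotient.exact (Quotient.out_eq (cls f)))

/-- The set `S` with `f = p χ_S`, where `p` is the representative of the class of `f`. -/
def label (f : BoolFn k) : Finset (Fin k) := (exists_label f).choose

theorem rep_mul_chi_label (f : BoolFn k) : rep (cls f) * chi (label f) = f :=
  (exists_label f).choose_spec.symm

theorem eq_rep_mul_chi_iff {f : BoolFn k} {S : Finset (Fin k)} :
    f = rep (cls f) * chi S ↔ S = label f := by
  constructor
  · intro h
    apply chi_injective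
    apply mul_left_cancel (a := rep (cls f))
    rw [rep_mul_chi_label, ← h]
  · rintro rfl
    exact (rep_mul_chi_label f).symm

theorem cls_mul_chi (f : BoolFn k) (U : Finset (Fin k)) : cls (f * chi U) = cls f :=
  Quotient.sound ⟨U, rfl⟩

theorem label_mul_chi (f : BoolFn k) (U : Finset (Fin k)) :
    label (f * chi U) = symmDiff (label f) U := by
  refine (eq_rep_mul_chi_iff.1 ?_).symm
  rw [cls_mul_chi, ← chi_mul, ← mul_assoc, rep_mul_chi_label]

theorem rep_mul_chi_symmDiff (f : BoolFn k) (U : Finset (Fin k)) :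
    rep (cls f) * chi (symmDiff (label f) U) = f * chi U := by
  rw [← chi_mul, ← mul_assoc, rep_mul_chi_label]

theorem game_sat_iff {η : unitInterval} {e : BoolFn k × BoolFn k} {a b : Finset (Fin k)} :
    (game k η).sat e a b ↔ a = symmDiff b (symmDiff (label e.1) (label e.2)) := by
  constructor
  · rintro ⟨S, T, U, hS, hT, rfl, rfl⟩
    rw [eq_rep_mul_chi_iff.1 hS, eq_rep_mul_chi_iff.1 hT]
    ext i
    simp only [Finset.mem_symmDiff]
    tauto
  · intro h
    refine ⟨label e.1, label e.2, symmDiff b (label e.2), eq_rep_mul_chi_iff.2 rfl,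
      eq_rep_mul_chi_iff.2 rfl, ?_, ?_⟩
    · rw [h, symmDiff_left_comm]
    · rw [symmDiff_comm b, symmDiff_symmDiff_cancel_left]

theorem game_isUniqueGame (η : unitInterval) : (game k η).IsUniqueGame := fun e =>
  ⟨(symmDiff_right_involutive (symmDiff (label e.1) (label e.2))).toPerm, fun a b => by
    rw [game_sat_iff, symmDiff_comm]
    rfl⟩

-- The satisfying pairs are parametrized by U as the labels of f χ_U and g χ_U, so sums over them
-- become sums over common shifts of (f, g).
open Classical in
theorem sum_sat_eq {M : Type*} [AddCommMonoid M] (η : unitInterval) (e : BoolFn k × BoolFn k)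
    (φ : Finset (Fin k) → Finset (Fin k) → M) :
    ∑ a, ∑ b, (if (game k η).sat e a b then φ a b else 0) =
      ∑ U, φ (label (e.1 * chi U)) (label (e.2 * chi U)) := by
  rw [Finset.sum_comm]
  simp only [game_sat_iff, Finset.sum_ite_eq', Finset.mem_univ, if_true]
  rw [← Equiv.sum_comp (symmDiff_right_involutive (label e.2)).toPerm]
  refine Finset.sum_congr rfl fun U _ => ?_
  rw [label_mul_chi, label_mul_chi]
  congr 1
  simp only [Function.Involutive.coe_toPerm]
  rw [symmDiff_comm (label e.2) U, symmDiff_assoc, symmDiff_comm (label e.1) (label e.2),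
    symmDiff_symmDiff_cancel_left, symmDiff_comm]

theorem card_boolFn : (Fintype.card (BoolFn k) : ℝ) = 2 ^ Fintype.card (Cube k) := by
  simp [BoolFn]

theorem game_weight (η : unitInterval) (e : BoolFn k × BoolFn k) :
    (game k η).weight e = ∏ x, signKernel (1 - 2 * (η : ℝ)) (e.1 x) (e.2 x) := by
  have h : ∀ u v : ℤˣ, signKernel (1 - 2 * (η : ℝ)) u v =
      2⁻¹ * if u = v then 1 - (η : ℝ) else η := by
    intro u v
    unfold signKernel
    split_ifs <;> ring
  simp only [game, h, Finset.prod_mul_distrib, Finset.prod_const, Finset.card_univ, card_boolFn,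
    inv_pow]

/-- The sum over `g` of `w(f, g)` for the weights of noise with correlation `r`. -/
theorem sum_prod_signKernel (r : ℝ) {ι : Type*} [Fintype ι] [DecidableEq ι] (f : ι → ℤˣ) :
    ∑ g : ι → ℤˣ, ∏ x, signKernel r (f x) (g x) = (2 ^ Fintype.card ι)⁻¹ := by
  have h : ∀ u : ℤˣ, ∑ v, signKernel r u v = 2⁻¹ := by
    intro u
    rcases Int.units_eq_one_or u with rfl | rfl <;>
    · rw [sum_intUnits]
      simp [signKernel]
      ring
  rw [← Fintype.prod_sum fun x v => signKernel r (f x) v]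
  simp only [h, Finset.prod_const, Finset.card_univ, inv_pow]

theorem sum_prod_signKernel_mul (r : ℝ) {ι : Type*} [Fintype ι] [DecidableEq ι] (f : ι → ℤˣ)
    (y : ι) : ∑ g : ι → ℤˣ, (∏ x, signKernel r (f x) (g x)) * (((f y : ℤ) : ℝ) * ((g y : ℤ) : ℝ))
      = (2 ^ Fintype.card ι)⁻¹ * r := by
  -- The sum factors over coordinates; only the factor at y sees the correlation.
  have h : ∀ x : ι, ∑ v, signKernel r (f x) v *
      (if x = y then ((f x : ℤ) : ℝ) * ((v : ℤ) : ℝ) else 1) = 2⁻¹ * if x = y then r else 1 := by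
    intro x
    rw [sum_intUnits]
    generalize f x = u
    by_cases hxy : x = y <;> rcases Int.units_eq_one_or u with rfl | rfl <;>
    · simp [signKernel, hxy]
      ring
  calc _ = ∑ g : ι → ℤˣ, ∏ x, (signKernel r (f x) (g x) *
        (if x = y then ((f x : ℤ) : ℝ) * ((g x : ℤ) : ℝ) else 1)) := by
        refine Finset.sum_congr rfl fun g _ => ?_
        rw [Finset.prod_mul_distrib, Fintype.prod_ite_eq']
    _ = _ := by
        rw [← Fintype.prod_sum fun x v => signKernel r (f x) v *
          (if x = y then ((f x : ℤ) : ℝ) * ((v : ℤ) : ℝ) else 1)]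
        simp only [h, Finset.prod_mul_distrib, Fintype.prod_ite_eq', Finset.prod_const,
          Finset.card_univ, inv_pow]

theorem game_totalWeight (η : unitInterval) : (game k η).totalWeight = 1 := by
  simp only [TwoCSP.totalWeight, game_weight, Fintype.sum_prod_type, sum_prod_signKernel,
    Finset.sum_const, Finset.card_univ, nsmul_eq_mul, card_boolFn]
  exact mul_inv_cancel₀ (by positivity)

/-! ### Soundness -/

theorem sum_mul_chi {M : Type*} [AddCommMonoid M] (φ : BoolFn k → M) (U : Finset (Fin k)) :
    ∑ f, φ (f * chi U) = ∑ f, φ f :=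
  Equiv.sum_comp (Equiv.mulRight (chi U)) φ

/-- The indicator of the functions to which the assignment `A` gives their own label. -/
def hit (A : Class k → Finset (Fin k)) (f : BoolFn k) : ℝ :=
  if label f = A (cls f) then 1 else 0

theorem hit_nonneg (A : Class k → Finset (Fin k)) (f : BoolFn k) : 0 ≤ hit A f := by
  unfold hit
  split_ifs <;> norm_num

theorem hit_rpow (A : Class k → Finset (Fin k)) (f : BoolFn k) {q : ℝ} (hq : q ≠ 0) :
    hit A f ^ q = hit A f := by
  unfold hit
  split_ifs
  · exact Real.one_rpow q
  · exact Real.zero_rpow hq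

/-- As U varies, the labels of f χ_U run once through all R subsets, so exactly one shift of f is
hit. -/
theorem mean_hit (A : Class k → Finset (Fin k)) :
    (∑ f, hit A f) / 2 ^ Fintype.card (Cube k) = (2 ^ k)⁻¹ := by
  have h : (2 ^ k : ℝ) * ∑ f, hit A f = 2 ^ Fintype.card (Cube k) := by
    calc _ = ∑ U : Finset (Fin k), ∑ f, hit A (f * chi U) := by
          simp [sum_mul_chi]
      _ = ∑ f : BoolFn k, ∑ U, hit A (f * chi U) := Finset.sum_comm
      _ = ∑ f : BoolFn k, 1 := by
          refine Finset.sum_congr rfl fun f _ => ?_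
          simp only [hit, label_mul_chi, cls_mul_chi]
          exact (Equiv.sum_comp (symmDiff_right_involutive (label f)).toPerm
            fun U => if U = A (cls f) then (1 : ℝ) else 0).trans (by simp)
      _ = _ := by
          rw [Finset.sum_const, nsmul_one, Finset.card_univ, card_boolFn]
  rw [div_eq_iff (by positivity), ← h]
  field_simp

open Classical in
/-- The weight of the constraints satisfied by a pair of assignments, one for the first and one
for the second variables of the constraints. -/
theorem sum_weight_sat_le {η : unitInterval} (hη : (η : ℝ) ≤ 1 / 2)
    (A B : Class k → Finset (Fin k)) :
    ∑ e, (game k η).weight e * (if (game k η).sat e (A (cls e.1)) (B (cls e.2)) then 1 else 0)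
      ≤ (2 ^ k : ℝ) ^ (2 * (1 - 2 * (η : ℝ))) / 2 ^ k := by
  set r : ℝ := 1 - 2 * (η : ℝ) with hr
  have hr0 : 0 ≤ r := by linarith
  have hr1 : r ≤ 1 := by linarith [η.2.1]
  have hsat : ∀ e : BoolFn k × BoolFn k,
      (if (game k η).sat e (A (cls e.1)) (B (cls e.2)) then (1 : ℝ) else 0) =
        ∑ U, hit A (e.1 * chi U) * hit B (e.2 * chi U) := by
    intro e
    have := sum_sat_eq η e fun a b => (if a = A (cls e.1) then (1 : ℝ) else 0) *
      if b = B (cls e.2) then 1 else 0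
    simp only [hit, cls_mul_chi]
    rw [← this, Finset.sum_eq_single (A (cls e.1)), Finset.sum_eq_single (B (cls e.2))]
    · simp
    · intro b _ hb
      simp [hb]
    · simp
    · intro a _ ha
      simp [ha]
    · simp
  have hw : ∀ (U : Finset (Fin k)) (f g : BoolFn k),
      ∏ x, signKernel r ((f * chi U) x) ((g * chi U) x) = ∏ x, signKernel r (f x) (g x) := by
    intro U f g
    refine Finset.prod_congr rfl fun x _ => ?_
    simp only [signKernel, Pi.mul_apply, mul_left_inj]
  have hshift : ∀ U : Finset (Fin k),
      ∑ f, ∑ g, (∏ x, signKernel r (f x) (g x)) * (hit A (f * chi U) * hit B (g * chi U)) =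
        ∑ f, ∑ g, (∏ x, signKernel r (f x) (g x)) * (hit A f * hit B g) := by
    intro U
    rw [← sum_mul_chi _ U]
    refine Finset.sum_congr rfl fun f _ => ?_
    rw [← sum_mul_chi _ U]
    refine Finset.sum_congr rfl fun g _ => ?_
    rw [hw, mul_assoc f, mul_assoc g, chi_mul_self, mul_one, mul_one, ← hw U]
  have hhyp := sum_prod_signKernel_le hr0 hr1 (hit A) (hit B) (hit_nonneg A) (hit_nonneg B)
  -- Indicators equal their own powers, provided the exponent is nonzero (0 ^ 0 = 1).
  have hq : 1 / (1 + r) ≠ 0 := by positivity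
  simp only [hit_rpow A _ hq, hit_rpow B _ hq, mean_hit] at hhyp
  calc _ = ∑ U : Finset (Fin k), ∑ f, ∑ g,
        (∏ x, signKernel r (f x) (g x)) * (hit A (f * chi U) * hit B (g * chi U)) := by
        simp only [hsat, game_weight, Fintype.sum_prod_type, Finset.mul_sum]
        rw [Finset.sum_comm (γ := Finset (Fin k))]
        refine Finset.sum_congr rfl fun f _ => ?_
        rw [Finset.sum_comm (γ := Finset (Fin k))]
    _ = 2 ^ k * ∑ f, ∑ g, (∏ x, signKernel r (f x) (g x)) * (hit A f * hit B g) := by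
        simp [hshift]
    _ ≤ 2 ^ k * ((2 ^ k)⁻¹ ^ (1 / (1 + r)) * (2 ^ k)⁻¹ ^ (1 / (1 + r))) := by gcongr
    _ ≤ _ := by
        have h2 : (1 : ℝ) ≤ 2 ^ k := one_le_pow₀ (by norm_num)
        have h20 : (0 : ℝ) < 2 ^ k := by positivity
        generalize (2 ^ k : ℝ) = R at *
        rw [Real.inv_rpow h20.le, ← Real.rpow_neg h20.le, ← Real.rpow_add h20,
          show ∀ s : ℝ, R * R ^ s = R ^ (1 + s) from fun s => by
            rw [Real.rpow_add h20, Real.rpow_one], ← Real.rpow_sub_one h20.ne']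
        refine Real.rpow_le_rpow_of_exponent_le h2 ?_
        -- This turns the exponent 1 - 2/(1+r) into the simpler bound 2r - 1.
        have h3 : 1 - r ≤ 1 / (1 + r) := by
          rw [le_div_iff₀ (by positivity)]
          nlinarith [sq_nonneg r]
        linarith

/-! ### The tensored solution -/

theorem inner_unitVec (f g : BoolFn k) :
    inner ℝ (unitVec f) (unitVec g) = (2 ^ k)⁻¹ * ∑ x, ((f x : ℤ) : ℝ) * ((g x : ℤ) : ℝ) := by
  have h : √(2 ^ k : ℝ) * √(2 ^ k : ℝ) = 2 ^ k := Real.mul_self_sqrt (by positivity)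
  simp only [unitVec, PiLp.inner_apply, Finset.mul_sum]
  refine Finset.sum_congr rfl fun x _ => ?_
  simp only [RCLike.inner_apply, conj_trivial]
  rw [div_mul_div_comm, h]
  ring

theorem inner_tensoredSolution (v w : Class k) (S T : Finset (Fin k)) :
    inner ℝ (tensoredSolution k v S) (tensoredSolution k w T) =
      (2 ^ k)⁻¹ * inner ℝ (unitVec (rep v * chi S)) (unitVec (rep w * chi T)) ^ 2 := by
  have h : (√(2 ^ k : ℝ))⁻¹ * (√(2 ^ k : ℝ))⁻¹ = (2 ^ k)⁻¹ := by
    rw [← mul_inv, Real.mul_self_sqrt (by positivity)]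
  rw [tensoredSolution, tensoredSolution, TensorProduct.smul_tmul', TensorProduct.smul_tmul',
    TensorProduct.inner_tmul, real_inner_smul_left, real_inner_smul_right]
  linear_combination inner ℝ (unitVec (rep v * chi S)) (unitVec (rep w * chi T)) ^ 2 * h

theorem inner_unitVec_mul_chi (f g : BoolFn k) (S T : Finset (Fin k)) :
    inner ℝ (unitVec (f * chi S)) (unitVec (g * chi T)) =
      (2 ^ k)⁻¹ * ∑ x, (((f * g * chi (symmDiff S T)) x : ℤ) : ℝ) := by
  rw [inner_unitVec]
  congr 1
  refine Finset.sum_congr rfl fun x _ => ?_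
  rw [← chi_mul]
  simp only [Pi.mul_apply, Units.val_mul, Int.cast_mul]
  ring

theorem inner_unitVec_mul_chi_self (f g : BoolFn k) (S : Finset (Fin k)) :
    inner ℝ (unitVec (f * chi S)) (unitVec (g * chi S)) = inner ℝ (unitVec f) (unitVec g) := by
  rw [inner_unitVec_mul_chi, inner_unitVec, symmDiff_self]
  simp [chi]

theorem inner_unitVec_self (f : BoolFn k) : inner ℝ (unitVec f) (unitVec f) = 1 := by
  rw [inner_unitVec]
  have : ∀ u : ℤˣ, ((u : ℤ) : ℝ) * ((u : ℤ) : ℝ) = 1 := fun u => by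
    rw [← Int.cast_mul, ← Units.val_mul, Int.units_mul_self]
    simp
  simp [this]

theorem sdpFeasible_tensoredSolution : SDPFeasible (tensoredSolution k) where
  sum_norm_sq v := by
    have : ∀ S, ‖tensoredSolution k v S‖ ^ 2 = (2 ^ k)⁻¹ := fun S => by
      rw [← real_inner_self_eq_norm_sq, inner_tensoredSolution, inner_unitVec_self, one_pow,
        mul_one]
    simp [this]
  orthogonal v S T hST := by
    rw [inner_tensoredSolution, inner_unitVec_mul_chi]
    have : rep v * rep v = 1 := funext fun x => Int.units_mul_self _
    rw [this, one_mul, sum_chi_eq_zero]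
    · simp
    · rwa [← Finset.bot_eq_empty, Ne, symmDiff_eq_bot]
  nonneg v w S T := by
    rw [inner_tensoredSolution]
    positivity

theorem sdpCost_tensoredSolution (η : unitInterval) :
    (game k η).sdpCost (tensoredSolution k) =
      ∑ e, (game k η).weight e * inner ℝ (unitVec e.1) (unitVec e.2) ^ 2 := by
  rw [TwoCSP.sdpCost, game_totalWeight, div_one]
  refine Finset.sum_congr rfl fun e _ => ?_
  rw [sum_sat_eq]
  congr 1
  calc _ = ∑ U : Finset (Fin k), (2 ^ k)⁻¹ * inner ℝ (unitVec e.1) (unitVec e.2) ^ 2 := by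
        refine Finset.sum_congr rfl fun U _ => ?_
        rw [inner_tensoredSolution, label_mul_chi, label_mul_chi]
        change _ * inner ℝ (unitVec (rep (cls e.1) * _)) (unitVec (rep (cls e.2) * _)) ^ 2 = _
        rw [rep_mul_chi_symmDiff, rep_mul_chi_symmDiff, inner_unitVec_mul_chi_self]
    _ = _ := by simp

theorem sum_weight_mul_inner (η : unitInterval) :
    ∑ e, (game k η).weight e * inner ℝ (unitVec e.1) (unitVec e.2) = 1 - 2 * (η : ℝ) := by
  simp only [game_weight, Fintype.sum_prod_type, inner_unitVec]
  calc _ = ∑ f : BoolFn k, ∑ x, (2 ^ k)⁻¹ * ∑ g : BoolFn k,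
        (∏ x, signKernel (1 - 2 * (η : ℝ)) (f x) (g x)) * (((f x : ℤ) : ℝ) * ((g x : ℤ) : ℝ)) := by
        refine Finset.sum_congr rfl fun f _ => ?_
        simp only [Finset.mul_sum]
        rw [Finset.sum_comm]
        refine Finset.sum_congr rfl fun x _ => Finset.sum_congr rfl fun g _ => ?_
        ring
    _ = _ := by
        simp only [sum_prod_signKernel_mul, Finset.sum_const, Finset.card_univ, nsmul_eq_mul,
          card_boolFn]
        have : (Fintype.card (Cube k) : ℝ) = 2 ^ k := by simp
        rw [this]
        field_simp

/-- The variance of ⟪u_f, u_g⟫ under the weights is nonnegative, and its mean is 1 - 2η. -/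
theorem sq_le_sdpCost_tensoredSolution (η : unitInterval) :
    (1 - 2 * (η : ℝ)) ^ 2 ≤ (game k η).sdpCost (tensoredSolution k) := by
  rw [sdpCost_tensoredSolution]
  have h : 0 ≤ ∑ e, (game k η).weight e *
      (inner ℝ (unitVec e.1) (unitVec e.2) - (1 - 2 * (η : ℝ))) ^ 2 :=
    Finset.sum_nonneg fun e _ => mul_nonneg ((game k η).weight_nonneg e) (sq_nonneg _)
  have h1 := sum_weight_mul_inner (k := k) η
  have h2 : ∑ e, (game k η).weight e = 1 := game_totalWeight η
  have h3 : ∑ e, (game k η).weight e *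
      (inner ℝ (unitVec e.1) (unitVec e.2) - (1 - 2 * (η : ℝ))) ^ 2 =
      ∑ e, (game k η).weight e * inner ℝ (unitVec e.1) (unitVec e.2) ^ 2
        - 2 * (1 - 2 * (η : ℝ)) * ∑ e, (game k η).weight e * inner ℝ (unitVec e.1) (unitVec e.2)
        + (1 - 2 * (η : ℝ)) ^ 2 * ∑ e, (game k η).weight e := by
    simp only [Finset.mul_sum, ← Finset.sum_sub_distrib, ← Finset.sum_add_distrib]
    refine Finset.sum_congr rfl fun e _ => ?_
    ring
  rw [h3, h1, h2] at h
  linarith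

end KhotVishnoi

/-! ### Optima of Max 2CSP instances -/

namespace TwoCSP

variable {V L E : Type*} [Fintype E]

theorem totalWeight_nonneg (I : TwoCSP V L E) : 0 ≤ I.totalWeight :=
  Finset.sum_nonneg fun e _ => I.weight_nonneg e

theorem cost_le_opt [Finite V] [Finite L] (I : TwoCSP V L E) (A : V → L) : I.cost A ≤ I.opt :=
  le_ciSup (Set.finite_range _).bddAbove A

theorem opt_le [Nonempty (V → L)] (I : TwoCSP V L E) {c : ℝ} (h : ∀ A, I.cost A ≤ c) :
    I.opt ≤ c :=
  ciSup_le h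

theorem cost_pos (I : TwoCSP V L E) (A : V → L) (e : E) (he : 0 < I.weight e)
    (hA : I.sat e (A (I.left e)) (A (I.right e))) : 0 < I.cost A := by
  classical
  refine div_pos (lt_of_lt_of_le he ?_) (lt_of_lt_of_le he ?_)
  · refine le_trans (le_of_eq ?_) (Finset.single_le_sum
      (f := fun e => I.weight e * (if I.sat e (A (I.left e)) (A (I.right e)) then 1 else 0))
      (fun e _ => mul_nonneg (I.weight_nonneg e) (by split_ifs <;> norm_num)) (Finset.mem_univ e))
    simp only [if_pos hA, mul_one]
  · exact Finset.single_le_sum (fun e _ => I.weight_nonneg e) (Finset.mem_univ e)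

end TwoCSP

/-! ### Feasible solutions of the semidefinite relaxation -/

section SDP

variable {V L H : Type*} [Fintype L] [NormedAddCommGroup H] [InnerProductSpace ℝ H]
  {x : V → L → H}

theorem SDPFeasible.comp (hx : SDPFeasible x) {V' : Type*} (φ : V' → V) :
    SDPFeasible fun v => x (φ v) :=
  ⟨fun _ => hx.sum_norm_sq _, fun _ => hx.orthogonal _, fun _ _ => hx.nonneg _ _⟩

theorem SDPFeasible.map (hx : SDPFeasible x) {H' : Type*} [NormedAddCommGroup H']
    [InnerProductSpace ℝ H'] (φ : H →ₗᵢ[ℝ] H') : SDPFeasible fun v a => φ (x v a) where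
  sum_norm_sq v := by simpa using hx.sum_norm_sq v
  orthogonal v a b h := by simpa using hx.orthogonal v a b h
  nonneg v w a b := by simpa using hx.nonneg v w a b

/-- Pythagoras. With Cauchy–Schwarz it bounds every cost by 1, so the supremum in `sdpOpt` is over a
bounded set and not the default value 0. -/
theorem SDPFeasible.norm_sum (hx : SDPFeasible x) (v : V) : ‖∑ a, x v a‖ = 1 := by
  rw [← sq_eq_sq₀ (norm_nonneg _) zero_le_one, one_pow, ← hx.sum_norm_sq v,
    ← real_inner_self_eq_norm_sq, sum_inner]
  refine Finset.sum_congr rfl fun a _ => ?_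
  rw [inner_sum, Finset.sum_eq_single a (fun b _ hb => hx.orthogonal v a b hb.symm) (by simp),
    real_inner_self_eq_norm_sq]

theorem SDPFeasible.sum_inner_le_one (hx : SDPFeasible x) (v w : V) :
    ∑ a, ∑ b, inner ℝ (x v a) (x w b) ≤ 1 := by
  have h := real_inner_le_norm (∑ a, x v a) (∑ b, x w b)
  rw [hx.norm_sum, hx.norm_sum, mul_one, sum_inner] at h
  simpa only [inner_sum] using h

variable {E : Type*} [Fintype E]

theorem SDPFeasible.sdpCost_le_one (hx : SDPFeasible x) (I : TwoCSP V L E) :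
    I.sdpCost x ≤ 1 := by
  classical
  refine div_le_one_of_le₀ ?_ I.totalWeight_nonneg
  refine Finset.sum_le_sum fun e _ => mul_le_of_le_one_right (I.weight_nonneg e) ?_
  refine le_trans ?_ (hx.sum_inner_le_one (I.left e) (I.right e))
  refine Finset.sum_le_sum fun a _ => Finset.sum_le_sum fun b _ => ?_
  split_ifs
  · exact le_rfl
  · exact hx.nonneg _ _ a b

theorem SDPFeasible.sdpCost_le_sdpOpt [FiniteDimensional ℝ H] (hx : SDPFeasible x)
    (I : TwoCSP V L E) : I.sdpCost x ≤ I.sdpOpt := by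
  refine le_csSup ⟨1, ?_⟩ ⟨Module.finrank ℝ H,
    fun v a => (stdOrthonormalBasis ℝ H).repr.toLinearIsometry (x v a), hx.map _, ?_⟩
  · rintro _ ⟨d, y, hy, rfl⟩
    exact hy.sdpCost_le_one I
  · simp only [TwoCSP.sdpCost, LinearIsometry.inner_map_map]

end SDP

/-! ### Unweighted copies of instances -/

namespace TwoCSP

variable {V L E : Type*}

/-- The bipartite double cover of an instance, with `m e` unweighted copies of the
constraint `e`. -/
def bipartiteCopy (I : TwoCSP V L E) (m : E → ℕ) : TwoCSP (V ⊕ V) L (Σ e, Fin (m e)) where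
  left e := Sum.inl (I.left e.1)
  right e := Sum.inr (I.right e.1)
  sat e := I.sat e.1
  weight _ := 1
  weight_nonneg _ := zero_le_one

theorem isUnweighted_bipartiteCopy (I : TwoCSP V L E) (m : E → ℕ) :
    (I.bipartiteCopy m).IsUnweighted := fun _ => rfl

theorem isLoopless_bipartiteCopy (I : TwoCSP V L E) (m : E → ℕ) :
    (I.bipartiteCopy m).IsLoopless := fun _ => Sum.inl_ne_inr

theorem sum_copies_div [Fintype E] (I : TwoCSP V L E) {m : E → ℕ} {t : ℝ} (ht : t ≠ 0)
    (hm : ∀ e, I.weight e = t * m e) (φ : E → ℝ) :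
    (∑ e : Sigma fun e => Fin (m e), 1 * φ e.1) / (I.bipartiteCopy m).totalWeight =
      (∑ e, I.weight e * φ e) / I.totalWeight := by
  simp only [totalWeight, hm, mul_assoc, ← Finset.mul_sum]
  rw [mul_div_mul_left _ _ ht]
  simp [bipartiteCopy, Fintype.sum_sigma]

open Classical in
theorem cost_bipartiteCopy [Fintype E] (I : TwoCSP V L E) {m : E → ℕ} {t : ℝ} (ht : t ≠ 0)
    (hm : ∀ e, I.weight e = t * m e) (A : V ⊕ V → L) :
    (I.bipartiteCopy m).cost A = (∑ e, I.weight e *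
      (if I.sat e (A (Sum.inl (I.left e))) (A (Sum.inr (I.right e))) then 1 else 0)) /
        I.totalWeight := by
  rw [← I.sum_copies_div ht hm]
  rfl

theorem sdpCost_bipartiteCopy [Fintype E] [Fintype L] {H : Type*} [NormedAddCommGroup H]
    [InnerProductSpace ℝ H] (I : TwoCSP V L E) {m : E → ℕ} {t : ℝ} (ht : t ≠ 0)
    (hm : ∀ e, I.weight e = t * m e) (x : V → L → H) :
    (I.bipartiteCopy m).sdpCost (fun v => x (Sum.elim id id v)) = I.sdpCost x := by
  rw [sdpCost, sdpCost, ← I.sum_copies_div ht hm]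
  rfl

/-- The instance obtained by renaming the variables and the constraints, and by embedding the set
of labels into a larger one. -/
def relabel {V' L' E' : Type*} (I : TwoCSP V L E) (v : V ≃ V') (l : L ↪ L') (c : E ≃ E') :
    TwoCSP V' L' E' where
  left e := v (I.left (c.symm e))
  right e := v (I.right (c.symm e))
  sat e a b := ∃ a' b', a = l a' ∧ b = l b' ∧ I.sat (c.symm e) a' b'
  weight e := I.weight (c.symm e)
  weight_nonneg _ := I.weight_nonneg _

section Relabel

variable {V' L' E' : Type*} (I : TwoCSP V L E) (v : V ≃ V') (l : L ↪ L') (c : E ≃ E')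

theorem relabel_sat_iff {e : E'} {a b : L} :
    (I.relabel v l c).sat e (l a) (l b) ↔ I.sat (c.symm e) a b := by
  constructor
  · rintro ⟨a', b', ha, hb, h⟩
    rwa [l.injective ha, l.injective hb]
  · exact fun h => ⟨a, b, rfl, rfl, h⟩

variable [Fintype E] [Fintype E']

theorem totalWeight_relabel : (I.relabel v l c).totalWeight = I.totalWeight :=
  c.symm.sum_comp I.weight

theorem cost_relabel (A : V → L) :
    (I.relabel v l c).cost (fun w => l (A (v.symm w))) = I.cost A := by
  classical
  rw [cost, cost, totalWeight_relabel, ← c.symm.sum_comp]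
  simp only [relabel_sat_iff]
  simp only [relabel, Equiv.symm_apply_apply]

theorem exists_cost_relabel_le [Nonempty L] (A : V' → L') :
    ∃ B : V → L, (I.relabel v l c).cost A ≤ I.cost B := by
  classical
  -- Labels outside the range of `l` satisfy no constraint, so replacing them arbitrarily loses
  -- nothing.
  refine ⟨fun w => Function.invFun l (A (v w)), ?_⟩
  rw [cost, cost, totalWeight_relabel, ← c.symm.sum_comp]
  refine div_le_div_of_nonneg_right (Finset.sum_le_sum fun e _ =>
    mul_le_mul_of_nonneg_left ?_ (I.weight_nonneg _)) I.totalWeight_nonneg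
  split_ifs with h1 h2 h2
  · exact le_rfl
  · obtain ⟨a, b, ha, hb, h⟩ := h1
    refine absurd ?_ h2
    change A (v _) = l a at ha
    change A (v _) = l b at hb
    rwa [ha, hb, Function.leftInverse_invFun l.injective, Function.leftInverse_invFun l.injective]
  · exact zero_le_one
  · exact le_rfl

variable {H : Type*} [NormedAddCommGroup H]

/-- A family of vectors, extended by zero to a larger set of labels. -/
def extendLabels (l : L ↪ L') (x : V → L → H) : V → L' → H :=
  fun w => Function.extend l (x w) 0

theorem extendLabels_apply (x : V → L → H) (w : V) (a : L) : extendLabels l x w (l a) = x w a :=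
  l.injective.extend_apply _ _ _

theorem extendLabels_of_notMem (x : V → L → H) (w : V) {a : L'} (ha : a ∉ Set.range l) :
    extendLabels l x w a = 0 :=
  Function.extend_apply' _ _ _ ha

variable [InnerProductSpace ℝ H] [Fintype L] [Fintype L']

theorem sdpFeasible_extendLabels {x : V → L → H} (hx : SDPFeasible x) :
    SDPFeasible (extendLabels l x) where
  sum_norm_sq w := by
    rw [← hx.sum_norm_sq w]
    refine (Fintype.sum_of_injective l l.injective _ _ (fun a ha => ?_) fun a => ?_).symm
    · simp [extendLabels_of_notMem l x w ha]
    · simp only [extendLabels_apply]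
  orthogonal w a b hab := by
    by_cases ha : a ∈ Set.range l
    · by_cases hb : b ∈ Set.range l
      · obtain ⟨a, rfl⟩ := ha
        obtain ⟨b, rfl⟩ := hb
        rw [extendLabels_apply, extendLabels_apply]
        exact hx.orthogonal w a b fun h => hab (congrArg l h)
      · rw [extendLabels_of_notMem l x w hb, inner_zero_right]
    · rw [extendLabels_of_notMem l x w ha, inner_zero_left]
  nonneg w w' a b := by
    by_cases ha : a ∈ Set.range l
    · by_cases hb : b ∈ Set.range l
      · obtain ⟨a, rfl⟩ := ha
        obtain ⟨b, rfl⟩ := hb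
        rw [extendLabels_apply, extendLabels_apply]
        exact hx.nonneg w w' a b
      · rw [extendLabels_of_notMem l x w' hb, inner_zero_right]
    · rw [extendLabels_of_notMem l x w ha, inner_zero_left]

theorem sdpCost_relabel (x : V → L → H) :
    (I.relabel v l c).sdpCost (fun w => extendLabels l x (v.symm w)) = I.sdpCost x := by
  classical
  rw [sdpCost, sdpCost, totalWeight_relabel, ← c.symm.sum_comp]
  congr 1
  refine Finset.sum_congr rfl fun e _ => congrArg _ ?_
  refine (Fintype.sum_of_injective l l.injective _ _ (fun a ha => ?_) fun a =>
    Fintype.sum_of_injective l l.injective _ _ (fun b hb => ?_) fun b => ?_).symm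
  · simp [extendLabels_of_notMem l x _ ha]
  · simp [extendLabels_of_notMem l x _ hb]
  · simp only [relabel_sat_iff, extendLabels_apply]
    simp only [relabel, Equiv.symm_apply_apply]

end Relabel

/-- A lower bound for the integrality gap from one instance with at most `R` labels. -/
theorem ofReal_div_le_integralityGap [Finite V] [Fintype L] [Fintype E] {H : Type*}
    [NormedAddCommGroup H] [InnerProductSpace ℝ H] [FiniteDimensional ℝ H] {R : ℕ}
    (I : TwoCSP V L E) (hu : I.IsUnweighted) (hl : I.IsLoopless) (l : L ↪ Fin R)
    {A : V → L} (hA : 0 < I.cost A) {o s : ℝ} (ho : ∀ B, I.cost B ≤ o)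
    {x : V → L → H} (hx : SDPFeasible x) (hs : s ≤ I.sdpCost x) (hs0 : 0 ≤ s) :
    ENNReal.ofReal (s / o) ≤ integralityGap R := by
  let v := Finite.equivFin V
  let c := Fintype.equivFin E
  let J := I.relabel v l c
  have hpos : 0 < J.opt := by
    rw [← I.cost_relabel v l c A] at hA
    exact hA.trans_le (J.cost_le_opt _)
  -- With no labels there would be no variables and no constraints, and the cost would be 0 / 0 = 0.
  have hL : Nonempty L := by
    by_contra h
    rw [not_nonempty_iff] at h
    have : IsEmpty V := ⟨fun w => h.elim (A w)⟩
    have : IsEmpty E := ⟨fun e => this.elim (I.left e)⟩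
    simp [cost] at hA
  have : Nonempty (Fin (Nat.card V) → Fin R) := ⟨fun _ => l hL.some⟩
  have hopt : J.opt ≤ o := J.opt_le fun B => by
    obtain ⟨B', hB'⟩ := I.exists_cost_relabel_le v l c B
    exact hB'.trans (ho B')
  have hsdp : s ≤ J.sdpOpt := by
    rw [← I.sdpCost_relabel v l c] at hs
    exact hs.trans (((sdpFeasible_extendLabels l hx).comp v.symm).sdpCost_le_sdpOpt J)
  have hu' : J.IsUnweighted := fun e => hu (c.symm e)
  have hl' : J.IsLoopless := fun e h => hl (c.symm e) (v.injective h)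
  refine le_trans (ENNReal.ofReal_le_ofReal (div_le_div₀ (hs0.trans hsdp) hsdp hpos hopt)) ?_
  unfold integralityGap
  exact le_iSup_of_le _ (le_iSup_of_le _ (le_iSup_of_le J (le_iSup_of_le hu'
    (le_iSup_of_le hl' (le_iSup_of_le hpos le_rfl)))))

end TwoCSP

/-! ### Optima of the Khot–Vishnoi instance and its unweighted version -/

namespace KhotVishnoi

variable {k : ℕ}

theorem game_weight_one_pos {η : unitInterval} (hη : (η : ℝ) < 1) :
    0 < (game k η).weight (1, 1) := by
  rw [game_weight]
  refine Finset.prod_pos fun x _ => ?_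
  simp only [signKernel, if_true]
  linarith

theorem game_sat_diag {η : unitInterval} (a : Finset (Fin k)) : (game k η).sat (1, 1) a a := by
  rw [game_sat_iff, symmDiff_self, symmDiff_bot]

theorem game_opt_pos {η : unitInterval} (hη : (η : ℝ) < 1) : 0 < (game k η).opt :=
  ((game k η).cost_pos (fun _ => ∅) (1, 1) (game_weight_one_pos hη)
    (game_sat_diag ∅)).trans_le ((game k η).cost_le_opt _)

theorem game_opt_le {η : unitInterval} (hη : (η : ℝ) ≤ 1 / 2) :
    (game k η).opt ≤ (2 ^ k : ℝ) ^ (2 * (1 - 2 * (η : ℝ))) / 2 ^ k := by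
  have : Nonempty (Class k → Finset (Fin k)) := ⟨fun _ => ∅⟩
  refine TwoCSP.opt_le _ fun A => ?_
  rw [TwoCSP.cost, game_totalWeight, div_one]
  exact sum_weight_sat_le hη A A

theorem sq_le_game_sdpOpt (η : unitInterval) : (1 - 2 * (η : ℝ)) ^ 2 ≤ (game k η).sdpOpt :=
  (sq_le_sdpCost_tensoredSolution η).trans
    (sdpFeasible_tensoredSolution.sdpCost_le_sdpOpt (game k η))

theorem one_sub_two_mul_noise : 1 - 2 * (noise k : ℝ) = 1 / (2 * Real.log (2 ^ k)) := by
  simp only [noise]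
  ring

theorem log_two_pow_pos (hk : 1 ≤ k) : 0 < Real.log (2 ^ k) :=
  Real.log_pos (one_lt_pow₀ one_lt_two (by omega))

theorem noise_lt_half (hk : 1 ≤ k) : (noise k : ℝ) < 1 / 2 := by
  have := log_two_pow_pos hk
  have h : 0 < 1 / (4 * Real.log (2 ^ k)) := by positivity
  simp only [noise]
  linarith

theorem opt_game_noise_le (hk : 1 ≤ k) : (game k (noise k)).opt ≤ Real.exp 1 / 2 ^ k := by
  have := (log_two_pow_pos hk).ne'
  refine (game_opt_le (noise_lt_half hk).le).trans (le_of_eq ?_)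
  rw [one_sub_two_mul_noise, Real.rpow_def_of_pos (by positivity)]
  congr 2
  field_simp

/-- A rational noise rate close to that of `noise`. -/
def rationalNoise (hk : 1 ≤ k) : unitInterval :=
  ⟨1 / 2 - 1 / (4 * k), by
    have h1 : (1 : ℝ) ≤ k := by exact_mod_cast hk
    have h2 : 1 / (4 * (k : ℝ)) ≤ 1 / 2 := one_div_le_one_div_of_le (by norm_num) (by linarith)
    have h3 : 0 ≤ 1 / (4 * (k : ℝ)) := by positivity
    exact ⟨by linarith, by linarith⟩⟩

theorem one_sub_two_mul_rationalNoise (hk : 1 ≤ k) :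
    1 - 2 * (rationalNoise hk : ℝ) = 1 / (2 * k) := by
  simp only [rationalNoise]
  ring

/-- The numbers of copies of the constraints which replace the weights of noise at the rate
`rationalNoise`. -/
def copies (k : ℕ) (e : BoolFn k × BoolFn k) : ℕ :=
  ∏ x, if e.1 x = e.2 x then 2 * k + 1 else 2 * k - 1

/-- With correlation 1/(2k) the two kernel values are (2k ± 1)/(8k), so a common denominator can be
pulled out. -/
theorem game_rationalNoise_weight (hk : 1 ≤ k) (e : BoolFn k × BoolFn k) :
    (game k (rationalNoise hk)).weight e =
      (1 / (8 * (k : ℝ))) ^ Fintype.card (Cube k) * copies k e := by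
  have h1 : (k : ℝ) ≠ 0 := by positivity
  rw [game_weight, one_sub_two_mul_rationalNoise, copies, Nat.cast_prod, ← Finset.card_univ,
    ← Finset.prod_const, ← Finset.prod_mul_distrib]
  refine Finset.prod_congr rfl fun x _ => ?_
  unfold signKernel
  split_ifs
  · push_cast
    field_simp
    ring
  · rw [Nat.cast_sub (by omega)]
    push_cast
    field_simp
    ring

theorem ofReal_le_integralityGap (hk : 1 ≤ k) {R : ℕ} (hR : 2 ^ k ≤ R) :
    ENNReal.ofReal (2 ^ k / (8 * (k : ℝ) ^ 2)) ≤ integralityGap R := by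
  classical
  have hk0 : (0 : ℝ) < k := by exact_mod_cast hk
  set η := rationalNoise hk
  have hr : 1 - 2 * (η : ℝ) = 1 / (2 * k) := one_sub_two_mul_rationalNoise hk
  have hη2 : (η : ℝ) ≤ 1 / 2 := by
    have : (0 : ℝ) ≤ 1 / (2 * k) := by positivity
    linarith
  obtain ⟨l⟩ : Nonempty (Finset (Fin k) ↪ Fin R) :=
    Function.Embedding.nonempty_of_card_le (by simpa using hR)
  have ht : (1 / (8 * (k : ℝ))) ^ Fintype.card (Cube k) ≠ 0 := by positivity
  have hm := game_rationalNoise_weight hk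
  have hcost := (game k η).cost_bipartiteCopy ht hm
  have hpos : 0 < copies k (1, 1) := Finset.prod_pos fun x _ => by simp
  have key := ((game k η).bipartiteCopy (copies k)).ofReal_div_le_integralityGap
    ((game k η).isUnweighted_bipartiteCopy _) ((game k η).isLoopless_bipartiteCopy _) l
    (A := fun _ => ∅) (TwoCSP.cost_pos _ _ ⟨(1, 1), ⟨0, hpos⟩⟩ zero_lt_one (game_sat_diag (η := η) ∅))
    -- With r = 1/(2k), the soundness factor (2^k)^(2r) is exactly 2.
    (o := 2 / 2 ^ k) (s := (1 - 2 * (η : ℝ)) ^ 2) (fun B => ?_)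
    (sdpFeasible_tensoredSolution.comp (Sum.elim id id))
    ((sq_le_sdpCost_tensoredSolution η).trans_eq
      ((game k η).sdpCost_bipartiteCopy ht hm (tensoredSolution k)).symm) (sq_nonneg _)
  · refine le_trans (le_of_eq ?_) key
    rw [hr]
    congr 1
    field_simp
    ring
  · rw [hcost, game_totalWeight, div_one]
    refine (sum_weight_sat_le hη2 (fun v => B (Sum.inl v)) fun v => B (Sum.inr v)).trans
      (le_of_eq ?_)
    rw [hr, ← Real.rpow_natCast 2 k, ← Real.rpow_mul zero_le_two,
      show (k : ℝ) * (2 * (1 / (2 * k))) = 1 by field_simp, Real.rpow_one]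

end KhotVishnoi

/-- For the largest 2^k ≤ R one has R ≤ 2 · 2^k and log R ≥ k/2; these lose factors 2 and 4 on top
of the 8 in `ofReal_le_integralityGap`, giving 64. -/
theorem div_log_sq_le_integralityGap {R : ℕ} (hR : 2 ≤ R) :
    ENNReal.ofReal (1 / 64 * (R / Real.log R ^ 2)) ≤ integralityGap R := by
  have hk : 1 ≤ Nat.log 2 R := Nat.log_pos one_lt_two hR
  have h1 : 2 ^ Nat.log 2 R ≤ R := Nat.pow_log_le_self 2 (by omega)
  have h2 : R < 2 ^ (Nat.log 2 R + 1) := Nat.lt_pow_succ_log_self one_lt_two R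
  generalize Nat.log 2 R = k at *
  refine le_trans (ENNReal.ofReal_le_ofReal ?_) (KhotVishnoi.ofReal_le_integralityGap hk h1)
  have hk0 : (0 : ℝ) < k := by exact_mod_cast hk
  have h1' : (2 : ℝ) ^ k ≤ R := by exact_mod_cast h1
  have h2' : (R : ℝ) ≤ 2 * 2 ^ k := by
    rw [← pow_succ']
    exact_mod_cast h2.le
  have hlog : (k : ℝ) / 2 ≤ Real.log R := by
    have := Real.log_le_log (by positivity) h1'
    rw [Real.log_pow] at this
    nlinarith [Real.log_two_gt_d9]
  calc 1 / 64 * (R / Real.log R ^ 2) ≤ 1 / 64 * (2 * 2 ^ k / ((k : ℝ) / 2) ^ 2) := by gcongr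
    _ = _ := by
      field_simp
      ring

end

theorem mainTheorem4 :
    (∀ (k R : ℕ), 1 ≤ k → R = 2 ^ k → ∀ η : unitInterval, η = KhotVishnoi.noise k →
      (KhotVishnoi.game k η).IsUniqueGame ∧
      Fintype.card (Finset (Fin k)) = R ∧
      0 < (KhotVishnoi.game k η).opt ∧
      (KhotVishnoi.game k η).opt ≤ Real.exp 1 / R ∧
      SDPFeasible (KhotVishnoi.tensoredSolution k) ∧
      (1 - 2 * (η : ℝ)) ^ 2 ≤
        (KhotVishnoi.game k η).sdpCost (KhotVishnoi.tensoredSolution k) ∧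
      (1 - 2 * (η : ℝ)) ^ 2 = 1 / (4 * Real.log R ^ 2) ∧
      1 / (4 * Real.log R ^ 2) ≤ (KhotVishnoi.game k η).sdpOpt ∧
      R / (4 * Real.exp 1 * Real.log R ^ 2) ≤
        (KhotVishnoi.game k η).sdpOpt / (KhotVishnoi.game k η).opt) ∧
    (∃ c : ℝ, 0 < c ∧ ∀ R : ℕ, 2 ≤ R →
      ENNReal.ofReal (c * (R / Real.log R ^ 2)) ≤ integralityGap R) := by
  refine ⟨?_, 1 / 64, by norm_num, fun R hR => div_log_sq_le_integralityGap hR⟩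
  rintro k R hk rfl η rfl
  push_cast
  have hpos : 0 < (KhotVishnoi.game k (KhotVishnoi.noise k)).opt :=
    KhotVishnoi.game_opt_pos ((KhotVishnoi.noise_lt_half hk).trans (by norm_num))
  have hopt := KhotVishnoi.opt_game_noise_le hk
  have hlog := KhotVishnoi.log_two_pow_pos hk
  have heq : (1 - 2 * (KhotVishnoi.noise k : ℝ)) ^ 2 = 1 / (4 * Real.log (2 ^ k) ^ 2) := by
    rw [KhotVishnoi.one_sub_two_mul_noise]
    ring
  have hsdp := KhotVishnoi.sq_le_game_sdpOpt (k := k) (KhotVishnoi.noise k)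
  rw [heq] at hsdp
  refine ⟨KhotVishnoi.game_isUniqueGame _, by simp, hpos, hopt,
    KhotVishnoi.sdpFeasible_tensoredSolution, KhotVishnoi.sq_le_sdpCost_tensoredSolution _, heq,
    hsdp, ?_⟩
  refine le_trans (le_of_eq ?_)
    (div_le_div₀ (le_trans (by positivity) hsdp) hsdp hpos hopt)
  field_simp
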